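/- Let $l,m\ge 1$ be integers with $lm\ge 2$. Let $B_{lm}$ be the Boolean algebra of subsets of $\{1,\dots,lm\}$, and let $\Delta(B_{lm})$ be its order complex, whose faces are the finite chains $u_0<\dots<u_i$ of elements with $\emptyset\subsetneq u_0$ and $u_i\subsetneq\{1,\dots,lm\}$. Let $S_l\wr S_m\subseteq S_{lm}$ be the subgroup of order $(l!)^m\,m!$ consisting of the permutations that preserve the partition of $\{1,\dots,lm\}$ into the $m$ blocks $\{il+1,\dots,(i+1)l\}$, $0\le i<m$; it acts on $B_{lm}$ and hence on the faces of $\Delta(B_{lm})$. The quotient complex $\Delta(B_{lm})/S_l\wr S_m$ is the cell complex whose cells are the $S_l\wr S_m$-orbits of nonempty faces of $\Delta(B_{lm})$; one cell is a face of another if some representative of the first is contained in some representative of the second. Theorem. The quotient complex $\Delta(B_{lm})/S_l\wr S_m$ is collapsible. That is, it can be reduced to a single vertex by a finite sequence of elementary collapses, where an elementary collapse deletes a cell $\tau$ together with a codimension-one face $\sigma$ of $\tau$ that is a proper face of no remaining cell other than $\tau$. -/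

import Mathlib

open scoped Pointwise

/-- The order complex `Δ(P)` of a bounded poset `P`: its faces are the nonempty finite chains of
elements lying strictly between the bottom `0̂` and the top `1̂` of `P`. -/
def orderComplex (P : Type*) [PartialOrder P] [BoundedOrder P] :
    PreAbstractSimplicialComplex P where
  faces := {c | c.Nonempty ∧ IsChain (· ≤ ·) (c : Set P) ∧ ∀ u ∈ c, ⊥ < u ∧ u < ⊤}
  isRelLowerSet_faces := fun _ hc =>
    ⟨hc.1, fun _ hdc hd =>
      ⟨hd, hc.2.1.mono (Finset.coe_subset.2 hdc), fun u hu => hc.2.2 u (hdc hu)⟩⟩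

section QuotientComplex

variable {V : Type*} [DecidableEq V] (K : PreAbstractSimplicialComplex V)
  (G : Type*) [Group G] [MulAction G V]

/-- Two faces of `K` are identified when they lie in the same orbit of `G`, where `G` acts on the
faces through its action on the vertices: `g • c = {g • v | v ∈ c}`. -/
def faceOrbitSetoid : Setoid {c : Finset V // c ∈ K.faces} where
  r c d := ∃ g : G, g • c.1 = d.1
  iseqv :=
    { refl := fun c => ⟨1, one_smul G c.1⟩
      symm := fun {c d} ⟨g, hg⟩ => ⟨g⁻¹, by rw [← hg, inv_smul_smul]⟩
      trans := fun {c d e} ⟨g, hg⟩ ⟨h, hh⟩ => ⟨h * g, by rw [mul_smul, hg, hh]⟩ }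

/-- The quotient complex `K / G` of a simplicial complex `K` on which a group `G` acts simplicially,
given by its poset of nonempty cells: a cell is a `G`-orbit of (nonempty) faces of `K`. -/
def QuotientComplex : Type _ := Quotient (faceOrbitSetoid K G)

/-- The face order of `K / G`: the cell of `c` is a face of the cell of `d` exactly when some
representative of the first orbit is contained in some representative of the second. -/
instance QuotientComplex.instPartialOrder : PartialOrder (QuotientComplex K G) where
  le p q := ∃ c d : {c : Finset V // c ∈ K.faces},
    Quotient.mk (faceOrbitSetoid K G) c = p ∧ Quotient.mk (faceOrbitSetoid K G) d = q ∧ c.1 ⊆ d.1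
  le_refl p := by
    obtain ⟨c, rfl⟩ := Quotient.exists_rep p
    exact ⟨c, c, rfl, rfl, subset_rfl⟩
  le_trans := by
    rintro _ _ _ ⟨c, d, rfl, rfl, hcd⟩ ⟨d', e, hd, rfl, hde⟩
    obtain ⟨g, hg⟩ := Quotient.exact hd.symm
    have hsub : g • c.1 ⊆ e.1 :=
      (Finset.smul_finset_subset_smul_finset hcd).trans (hg ▸ hde)
    have hface : g • c.1 ∈ K.faces :=
      (K.isRelLowerSet_faces e.2).2 hsub ((K.isRelLowerSet_faces c.2).1.smul_finset (a := g))
    have hmk : Quotient.mk (faceOrbitSetoid K G) c = Quotient.mk _ ⟨g • c.1, hface⟩ :=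
      Quotient.sound ⟨g, rfl⟩
    exact ⟨⟨g • c.1, hface⟩, e, hmk.symm, rfl, hsub⟩
  le_antisymm := by
    rintro _ _ ⟨c, d, rfl, rfl, hcd⟩ ⟨d', c', hd, hc, hdc⟩
    obtain ⟨g, hg⟩ := Quotient.exact hd
    obtain ⟨h, hh⟩ := Quotient.exact hc
    have h1 : d'.1.card = d.1.card := by rw [← hg, Finset.card_smul_finset]
    have h2 : c'.1.card = c.1.card := by rw [← hh, Finset.card_smul_finset]
    have h3 := Finset.card_le_card hdc
    have h4 : c.1 = d.1 := Finset.eq_of_subset_of_card_le hcd (by omega)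
    exact congrArg _ (Subtype.ext h4)

end QuotientComplex

section Collapsibility

variable {C : Type*} [PartialOrder C]

/-- An elementary collapse, for subcomplexes `K`, `L` (lower sets) of a cell complex whose poset of
nonempty cells is `C`: `L` arises from `K` by deleting a cell `τ` together with a free face `σ` of
it, that is, a facet `σ` of `τ` which is a proper face of no other cell of `K`. -/
def IsElementaryCollapse (K L : Set C) : Prop :=
  ∃ σ ∈ K, ∃ τ ∈ K, σ ⋖ τ ∧ (∀ ρ ∈ K, σ < ρ → ρ = τ) ∧ L = K \ {σ, τ}

variable (C) in
/-- A cell complex, given by its poset `C` of nonempty cells, is collapsible if a finite sequence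
of elementary collapses reduces it to a single vertex. -/
def IsCollapsible : Prop :=
  ∃ v : C, IsMin v ∧ Relation.ReflTransGen IsElementaryCollapse (Set.univ : Set C) {v}

end Collapsibility

/-- The wreath product `S_l ≀ S_m` as a subgroup of `S_{lm}`: the permutations of `0, …, lm - 1`
that preserve the partition into the `m` rows `{il, …, (i+1)l - 1}`, `0 ≤ i < m`, so that they
permute the elements inside the rows and the rows as a whole. -/
def wreathSubgroup (l m : ℕ) : Subgroup (Equiv.Perm (Fin (l * m))) where
  carrier := {π | ∀ x y, (π x : ℕ) / l = (π y : ℕ) / l ↔ (x : ℕ) / l = (y : ℕ) / l}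
  one_mem' := fun _ _ => Iff.rfl
  mul_mem' := fun {a b} ha hb x y => (ha (b x) (b y)).trans (hb x y)
  inv_mem' := fun {a} ha x y => by simpa using (ha (a⁻¹ x) (a⁻¹ y)).symm

/-- `Δ(B_{lm}) / S_l ≀ S_m`, where `B_{lm}` is the Boolean algebra of subsets of an `lm`-element set,
on which a permutation acts by `π • u = {π x | x ∈ u}`. -/
abbrev BooleanWreathQuotient (l m : ℕ) : Type :=
  QuotientComplex (orderComplex (Finset (Fin (l * m)))) (wreathSubgroup l m)

/-! The cells are paired by an acyclic matching, in the sense of discrete Morse theory, that leaves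
one vertex over. Let `l ≥ 2` and adjoin the full set to a chain `c`. The full set is not a partial
transversal of the rows, so there is a smallest member `x` that is not one. The partial transversals
in `c` lie inside `x`, and the largest of them extends to a partial transversal `y ⊆ x` meeting
every row that `x` meets. A chain without such a `y` is paired with the chain obtained by adding
one. The choice of `y` is not canonical, but two choices are exchanged, row by row, by an element of
the wreath product that fixes every other member of the chain (`exists_smul_eq_of_rowSet_eq`). Hence
the pairing is well defined on orbits. The empty chain, which is not a cell, takes a complete
transversal as its partner, and this is the vertex left over. For acyclicity, enlarging a chain
either adds a set that is not a partial transversal, or keeps the meaning of `y` and so cannot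
shrink what remains after deleting it. For `l = 1` every set is a partial transversal and the group
is the full symmetric group; a singleton inside the smallest member then plays the role of `y`. -/

/-! ### Collapsing along an acyclic matching. -/

section Matching

variable {C : Type*} [PartialOrder C]

/-- A finite cell complex with an acyclic matching `M` whose only unmatched cell is the vertex `v`
is collapsible. Acyclicity is witnessed by a rank `r`, constant on matched pairs, which increases
strictly from the lower cell of a pair to every larger cell outside the pair. -/
theorem isCollapsible_of_matching [Finite C] {R : Type*} [LinearOrder R]
    (M : C → C → Prop) (r : C → R) (v : C) (hmin : IsMin v)
    (hcov : ∀ σ τ, M σ τ → σ ⋖ τ) (hr : ∀ σ τ, M σ τ → r σ = r τ)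
    (hlt : ∀ σ τ ρ, M σ τ → σ < ρ → ρ ≠ τ → r σ < r ρ)
    (hinj : ∀ σ σ' τ, M σ τ → M σ' τ → σ = σ')
    (hex : ∀ c, c ≠ v → ∃ d, M c d ∨ M d c)
    (hv : ∀ c, ¬ M v c ∧ ¬ M c v) : IsCollapsible C := by
  refine ⟨v, hmin, ?_⟩
  have key : ∀ n : ℕ, ∀ K : Set C, K.ncard = n → v ∈ K →
      (∀ σ τ, M σ τ → (σ ∈ K ↔ τ ∈ K)) → Relation.ReflTransGen IsElementaryCollapse K {v} := by
    intro n
    induction n using Nat.strong_induction_on with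
    | _ n ih =>
    intro K hn hvK hK
    by_cases hKv : K = {v}
    · rw [hKv]
    have hpair : ∀ c ∈ K, c ≠ v → ∃ σ ∈ K, ∃ τ, M σ τ ∧ r σ = r c := by
      intro c hc hcv
      obtain ⟨d, hd | hd⟩ := hex c hcv
      · exact ⟨c, hc, d, hd, rfl⟩
      · exact ⟨d, (hK _ _ hd).2 hc, c, hd, hr _ _ hd⟩
    have hne : {σ | σ ∈ K ∧ ∃ τ, M σ τ}.Nonempty := by
      by_contra h
      refine hKv (Set.eq_singleton_iff_unique_mem.2 ⟨hvK, fun c hc => ?_⟩)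
      by_contra hcv
      obtain ⟨σ, hσ, τ, hM, -⟩ := hpair c hc hcv
      exact h ⟨σ, hσ, τ, hM⟩
    -- A lower cell of maximal rank is free: another coface in `K` would have larger rank, and so
    -- would the lower cell of its own pair, which is also in `K`.
    obtain ⟨σ, ⟨hσK, τ, hM⟩, hmax⟩ :=
      Set.exists_max_image _ r (Set.toFinite {σ | σ ∈ K ∧ ∃ τ, M σ τ}) hne
    have hτK := (hK _ _ hM).1 hσK
    have hστ := hcov _ _ hM
    have hσv : v ≠ σ := by rintro rfl; exact (hv τ).1 hM
    have hτv : v ≠ τ := by rintro rfl; exact (hv σ).2 hM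
    refine Relation.ReflTransGen.head (b := K \ {σ, τ})
      ⟨σ, hσK, τ, hτK, hστ, fun ρ hρ hσρ => ?_, rfl⟩
      (ih _ ?_ _ rfl ⟨hvK, by simp [hσv, hτv]⟩ ?_)
    · by_contra hρτ
      have h1 := hlt _ _ _ hM hσρ hρτ
      have hρv : ρ ≠ v := by
        rintro rfl
        exact hmin.not_lt hσρ
      obtain ⟨σ', hσ', τ', hM', hr'⟩ := hpair ρ hρ hρv
      have h2 := hmax σ' ⟨hσ', τ', hM'⟩
      rw [hr'] at h2
      exact absurd h1 h2.not_gt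
    · rw [← hn]
      exact Set.ncard_lt_ncard ⟨Set.sdiff_subset, fun h => (h hσK).2 (by simp)⟩
    · have hup : ∀ ρ, σ < ρ → r ρ = r σ → ρ = τ := fun ρ h1 h2 => by
        by_contra h
        exact absurd (hlt _ _ _ hM h1 h) h2.le.not_gt
      intro a b hab
      have hab1 := hcov _ _ hab
      have hab2 := hr _ _ hab
      -- The rank also prevents `σ` from being the upper cell, or `τ` the lower cell, of a second
      -- pair, so what remains of `K` is still a union of pairs and `v`.
      have e1 : (a = σ ∨ a = τ) ↔ (b = σ ∨ b = τ) := by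
        constructor
        · rintro (rfl | rfl)
          · exact Or.inr (hup b hab1.lt hab2.symm)
          · have := hup b (hστ.lt.trans hab1.lt) (hab2.symm.trans (hr _ _ hM).symm)
            exact absurd this hab1.lt.ne'
        · rintro (rfl | rfl)
          · by_contra h
            have h3 := hlt _ _ _ hab (hab1.lt.trans hστ.lt) hστ.lt.ne'
            exact absurd h3 (by rw [hab2, hr _ _ hM]; exact lt_irrefl _)
          · exact Or.inl (hinj _ _ _ hab hM)
      simp only [Set.mem_sdiff, Set.mem_insert_iff, Set.mem_singleton_iff, e1, hK _ _ hab]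
  exact key _ Set.univ rfl (Set.mem_univ _) (by simp)

end Matching

/-! ### From an equivariant deletion on faces to a matching on orbits. -/

namespace QuotientComplex

variable {V : Type*} [DecidableEq V] {K : PreAbstractSimplicialComplex V}
  {G : Type*} [Group G] [MulAction G V]

/-- The cell of a face. -/
def mk (c : Finset V) (hc : c ∈ K.faces) : QuotientComplex K G :=
  Quotient.mk (faceOrbitSetoid K G) ⟨c, hc⟩

theorem exists_mk (p : QuotientComplex K G) : ∃ c hc, mk c hc = p := by
  obtain ⟨⟨c, hc⟩, rfl⟩ := Quotient.exists_rep p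
  exact ⟨c, hc, rfl⟩

theorem mk_eq_mk {c d : Finset V} {hc : c ∈ K.faces} {hd : d ∈ K.faces} :
    (mk c hc : QuotientComplex K G) = mk d hd ↔ ∃ g : G, g • c = d :=
  ⟨fun h => Quotient.exact h, fun h => Quotient.sound h⟩

theorem mk_le_mk_of_subset {c d : Finset V} {hc : c ∈ K.faces} {hd : d ∈ K.faces} (h : c ⊆ d) :
    (mk c hc : QuotientComplex K G) ≤ mk d hd :=
  ⟨⟨c, hc⟩, ⟨d, hd⟩, rfl, rfl, h⟩

/-- A function on faces which is constant on orbits, as a function on cells. -/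
def liftFace {R : Type*} (f : Finset V → R) (hf : ∀ (g : G) c, f (g • c) = f c) :
    QuotientComplex K G → R :=
  Quotient.lift (fun c => f c.1) (by
    rintro a b ⟨g, hg⟩
    rw [← hg, hf])

theorem exists_superset_of_mk_le (hG : ∀ (g : G), ∀ c ∈ K.faces, g • c ∈ K.faces)
    {c : Finset V} {hc : c ∈ K.faces} {p : QuotientComplex K G}
    (h : mk c hc ≤ p) : ∃ e he, mk e he = p ∧ c ⊆ e := by
  obtain ⟨⟨c', hc'⟩, ⟨d, hd⟩, h1, h2, h3⟩ := h
  obtain ⟨g, hg⟩ := mk_eq_mk.1 (show (mk c' hc' : QuotientComplex K G) = mk c hc from h1)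
  have hsub : c ⊆ g • d := by
    rw [← hg]
    exact Finset.smul_finset_subset_smul_finset h3
  refine ⟨g • d, hG g d hd, ?_, hsub⟩
  rw [← h2]
  exact mk_eq_mk.2 ⟨g⁻¹, inv_smul_smul _ _⟩

theorem card_lt_card_of_lt {p q : QuotientComplex K G} (h : p < q) :
    liftFace Finset.card (fun g c => Finset.card_smul_finset g c) p <
      liftFace Finset.card (fun g c => Finset.card_smul_finset g c) q := by
  obtain ⟨c, d, rfl, rfl, hcd⟩ := h.le
  refine Finset.card_lt_card (hcd.ssubset_of_ne fun he => h.ne ?_)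
  exact congrArg _ (Subtype.ext he)

/-- If `L` is an equivariant map that deletes at most one vertex from each face, such that
up to the group every face fixed by `L` arises from exactly one larger face (this includes the
empty face), and `N` is an invariant such that passing to a larger face increases either `N` or the
remainder under `L`, then the quotient is collapsible: the cells of `L d` and `d` are matched. -/
theorem isCollapsible_of_retraction [Finite V]
    (hG : ∀ (g : G), ∀ c ∈ K.faces, g • c ∈ K.faces)
    (L : Finset V → Finset V) (N : Finset V → ℕ)
    (hsub : ∀ c, L c ⊆ c) (hsmul : ∀ (g : G) c, L (g • c) = g • L c)
    (hidem : ∀ c, L (L c) = L c) (hcard : ∀ c ∈ K.faces, c.card ≤ (L c).card + 1)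
    (hN : ∀ (g : G) c, N (g • c) = N c) (hNL : ∀ c, N (L c) = N c)
    (hlt : ∀ c, ∀ e ∈ K.faces, c ⊆ e → L c = c → N c < N e ∨ N c = N e ∧ c ⊆ L e)
    (hex : ∀ c, c ∈ K.faces ∨ c = ∅ → L c = c → ∃ d ∈ K.faces, L d = c ∧ d ≠ c)
    (huniq : ∀ d ∈ K.faces, ∀ e ∈ K.faces, L d = L e → d ≠ L d → e ≠ L e → ∃ g : G, g • d = e) :
    IsCollapsible (QuotientComplex K G) := by
  have hne : ∀ c ∈ K.faces, c.Nonempty := fun c hc => (K.isRelLowerSet_faces hc).1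
  have hdown : ∀ c ∈ K.faces, L c ≠ ∅ → L c ∈ K.faces := fun c hc h =>
    (K.isRelLowerSet_faces hc).2 (hsub c) (Finset.nonempty_iff_ne_empty.2 h)
  have hcov : ∀ c ∈ K.faces, c ≠ L c → c.card = (L c).card + 1 := fun c hc h =>
    le_antisymm (hcard c hc) (Finset.card_lt_card ((hsub c).ssubset_of_ne h.symm))
  have hL0 : L ∅ = ∅ := Finset.subset_empty.1 (hsub ∅)
  have hfin : Finite (QuotientComplex K G) := by
    classical
    unfold QuotientComplex
    infer_instance
  -- The partner of the empty face is a single vertex; as the empty face is no cell, this vertex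
  -- stays unmatched.
  obtain ⟨t, ht, htL, htne⟩ := hex ∅ (Or.inr rfl) hL0
  have htcard : t.card = 1 := by
    have := hcov t ht (by rw [htL]; exact htne)
    rwa [htL, Finset.card_empty] at this
  let r : QuotientComplex K G → ℕ ×ₗ ℕ :=
    liftFace (fun c => toLex (N c, (L c).card)) (fun g c => by
      rw [hN, hsmul, Finset.card_smul_finset])
  refine isCollapsible_of_matching
    (fun p q => ∃ d hd hLd, q = mk d hd ∧ p = mk (L d) hLd ∧ d ≠ L d) r (mk t ht)
    ?_ ?_ ?_ ?_ ?_ ?_ ?_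
  · intro p hp
    by_contra h
    have h1 := card_lt_card_of_lt (lt_of_le_not_ge hp h)
    obtain ⟨c, hc, rfl⟩ := exists_mk p
    have h2 : c.card < t.card := h1
    have := (hne c hc).card_pos
    omega
  · rintro _ _ ⟨d, hd, hLd, rfl, rfl, h⟩
    have h0 := hcov d hd h
    refine ⟨lt_of_le_of_ne (mk_le_mk_of_subset (hsub d)) fun he => ?_, fun s h1 h2 => ?_⟩
    · obtain ⟨g, hg⟩ := mk_eq_mk.1 he
      have := congrArg Finset.card hg
      rw [Finset.card_smul_finset] at this
      omega
    · have h1 := card_lt_card_of_lt h1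
      have h2 := card_lt_card_of_lt h2
      obtain ⟨c, hc, rfl⟩ := exists_mk s
      have h1 : (L d).card < c.card := h1
      have h2 : c.card < d.card := h2
      omega
  · rintro _ _ ⟨d, hd, hLd, rfl, rfl, h⟩
    change toLex (N (L d), (L (L d)).card) = toLex (N d, (L d).card)
    rw [hNL, hidem]
  · rintro _ _ ρ ⟨d, hd, hLd, rfl, rfl, h⟩ hσρ hρ
    obtain ⟨e, he, rfl, hsubset⟩ := exists_superset_of_mk_le hG hσρ.le
    change toLex (N (L d), (L (L d)).card) < toLex (N e, (L e).card)
    rw [Prod.Lex.toLex_lt_toLex, hidem]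
    refine (hlt (L d) e he hsubset (hidem d)).imp id fun ⟨h1, h2⟩ => ⟨h1, ?_⟩
    -- If the remainders agreed, uniqueness up to `G` would make `ρ` the partner of `σ`, unless `e`
    -- is its own remainder, in which case `ρ = σ`.
    refine Finset.card_lt_card (h2.ssubset_of_ne fun h3 => hρ ?_)
    refine (mk_eq_mk.2 (huniq d hd e he h3 h fun h4 => hσρ.ne ?_)).symm
    exact mk_eq_mk.2 ⟨1, by rw [one_smul, h3, ← h4]⟩
  · rintro _ _ _ ⟨d, hd, hLd, rfl, rfl, h⟩ ⟨e, he, hLe, hde, rfl, h'⟩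
    obtain ⟨g, rfl⟩ := mk_eq_mk.1 hde
    exact mk_eq_mk.2 ⟨g, (hsmul g d).symm⟩
  · intro p hp
    obtain ⟨c, hc, rfl⟩ := exists_mk p
    by_cases hLc : c = L c
    · obtain ⟨d, hd, rfl, hdc⟩ := hex c (Or.inl hc) hLc.symm
      exact ⟨mk d hd, Or.inl ⟨d, hd, hc, rfl, rfl, hdc⟩⟩
    · have h0 : L c ≠ ∅ := fun h0 =>
        hp (mk_eq_mk.2 (huniq c hc t ht (by rw [h0, htL]) hLc (by rw [htL]; exact htne)))
      exact ⟨mk (L c) (hdown c hc h0), Or.inr ⟨c, hc, hdown c hc h0, rfl, rfl, hLc⟩⟩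
  · intro p
    constructor
    · rintro ⟨d, hd, hLd, -, h, -⟩
      obtain ⟨g, hg⟩ := mk_eq_mk.1 h
      have h1 := hidem d
      rw [← hg, hsmul, htL, Finset.smul_finset_empty] at h1
      have := hne t ht
      rw [eq_comm, Finset.smul_finset_eq_empty] at h1
      exact htne h1
    · rintro ⟨d, hd, hLd, h, -, -⟩
      obtain ⟨g, hg⟩ := mk_eq_mk.1 h
      have h1 := hne _ hLd
      rw [← hg, hsmul, htL, Finset.smul_finset_empty] at h1
      exact Finset.not_nonempty_empty h1

end QuotientComplex
-- Partial transversals under the wreath product.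
section Wreath

variable {l m : ℕ}

theorem mem_orderComplex_finset {α : Type*} [Fintype α] {c : Finset (Finset α)} :
    c ∈ (orderComplex (Finset α)).faces ↔
      c.Nonempty ∧ (∀ u ∈ c, ∀ v ∈ c, u ⊆ v ∨ v ⊆ u) ∧ ∀ u ∈ c, u.Nonempty ∧ u ≠ Finset.univ := by
  refine and_congr_right fun _ => and_congr ⟨fun h u hu v hv => h.total hu hv, fun h u hu v hv _ =>
    h u hu v hv⟩ (forall₂_congr fun u _ => ?_)
  rw [bot_lt_iff_ne_bot, lt_top_iff_ne_top, Finset.nonempty_iff_ne_empty]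
  rfl

theorem mem_wreathSubgroup_smul {g : wreathSubgroup l m} {u : Finset (Fin (l * m))}
    {a : Fin (l * m)} : a ∈ g • u ↔ ∃ b ∈ u, g.1 b = a :=
  Finset.mem_smul_finset

theorem smul_subset_smul_wreath (g : wreathSubgroup l m) {u v : Finset (Fin (l * m))}
    (h : u ⊆ v) : g • u ⊆ g • v :=
  Finset.smul_finset_subset_smul_finset h

theorem smul_mem_orderComplex (g : wreathSubgroup l m) (c : Finset (Finset (Fin (l * m))))
    (hc : c ∈ (orderComplex (Finset (Fin (l * m)))).faces) :
    g • c ∈ (orderComplex (Finset (Fin (l * m)))).faces := by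
  rw [mem_orderComplex_finset] at hc ⊢
  obtain ⟨h1, h2, h3⟩ := hc
  refine ⟨h1.smul_finset, ?_, ?_⟩
  · intro u hu v hv
    obtain ⟨u, hu', rfl⟩ := Finset.mem_smul_finset.1 hu
    obtain ⟨v, hv', rfl⟩ := Finset.mem_smul_finset.1 hv
    exact (h2 u hu' v hv').imp (smul_subset_smul_wreath g) (smul_subset_smul_wreath g)
  · intro u hu
    obtain ⟨u, hu', rfl⟩ := Finset.mem_smul_finset.1 hu
    refine ⟨(h3 u hu').1.smul_finset, fun h => (h3 u hu').2 ?_⟩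
    rw [← Finset.card_eq_iff_eq_univ] at h ⊢
    rw [← h]
    exact (Finset.card_smul_finset g u).symm

/-- A set containing at most one element of each row. -/
def IsPartialTransversal (u : Finset (Fin (l * m))) : Prop :=
  ∀ a ∈ u, ∀ b ∈ u, (a : ℕ) / l = (b : ℕ) / l → a = b

/-- The rows which a set meets. -/
def rowSet (u : Finset (Fin (l * m))) : Set ℕ := (fun a : Fin (l * m) => (a : ℕ) / l) '' u

theorem IsPartialTransversal.mono {u v : Finset (Fin (l * m))} (hv : IsPartialTransversal v)
    (h : u ⊆ v) : IsPartialTransversal u :=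
  fun a ha b hb => hv a (h ha) b (h hb)

theorem rowSet_mono {u v : Finset (Fin (l * m))} (h : u ⊆ v) : rowSet u ⊆ rowSet v :=
  Set.image_mono (Finset.coe_subset.2 h)

theorem rowSet_subset_iff {u v : Finset (Fin (l * m))} :
    rowSet u ⊆ rowSet v ↔ ∀ a ∈ u, ∃ b ∈ v, (b : ℕ) / l = (a : ℕ) / l := by
  simp [rowSet, Set.subset_def]

theorem IsPartialTransversal.eq_of_subset {u v : Finset (Fin (l * m))}
    (hv : IsPartialTransversal v) (h : u ⊆ v) (hr : rowSet v ⊆ rowSet u) : u = v := by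
  refine h.antisymm fun a ha => ?_
  obtain ⟨b, hb, hba⟩ := rowSet_subset_iff.1 hr a ha
  rwa [← hv b (h hb) a ha hba]

theorem isPartialTransversal_smul (g : wreathSubgroup l m) (u : Finset (Fin (l * m))) :
    IsPartialTransversal (g • u) ↔ IsPartialTransversal u := by
  constructor
  · intro h a ha b hb hab
    exact g.1.injective (h _ (mem_wreathSubgroup_smul.2 ⟨a, ha, rfl⟩) _
      (mem_wreathSubgroup_smul.2 ⟨b, hb, rfl⟩) ((g.2 a b).2 hab))
  · intro h a ha b hb hab
    obtain ⟨a, ha', rfl⟩ := mem_wreathSubgroup_smul.1 ha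
    obtain ⟨b, hb', rfl⟩ := mem_wreathSubgroup_smul.1 hb
    rw [h a ha' b hb' ((g.2 a b).1 hab)]

theorem rowSet_smul_subset (g : wreathSubgroup l m) (u v : Finset (Fin (l * m))) :
    rowSet (g • u) ⊆ rowSet (g • v) ↔ rowSet u ⊆ rowSet v := by
  simp only [rowSet_subset_iff]
  constructor
  · intro h a ha
    obtain ⟨b, hb, hab⟩ := h _ (mem_wreathSubgroup_smul.2 ⟨a, ha, rfl⟩)
    obtain ⟨b, hb', rfl⟩ := mem_wreathSubgroup_smul.1 hb
    exact ⟨b, hb', (g.2 b a).1 hab⟩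
  · intro h a ha
    obtain ⟨a, ha', rfl⟩ := mem_wreathSubgroup_smul.1 ha
    obtain ⟨b, hb, hab⟩ := h a ha'
    exact ⟨_, mem_wreathSubgroup_smul.2 ⟨b, hb, rfl⟩, (g.2 b a).2 hab⟩

theorem smul_univ_wreath (g : wreathSubgroup l m) :
    g • (Finset.univ : Finset (Fin (l * m))) = Finset.univ :=
  Finset.smul_finset_univ

theorem smul_eq_self_of_subset (g : wreathSubgroup l m) {w : Finset (Fin (l * m))}
    (h : g • w ⊆ w) : g • w = w :=
  Finset.eq_of_subset_of_card_le h (Finset.card_smul_finset g w).ge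

/-- Two partial transversals of the same rows are exchanged by an element of the wreath product that
moves only their symmetric difference. -/
theorem exists_smul_eq_of_rowSet_eq {y y' : Finset (Fin (l * m))} (hy : IsPartialTransversal y)
    (hy' : IsPartialTransversal y') (h : rowSet y = rowSet y') :
    ∃ g : wreathSubgroup l m, g • y = y' ∧ (∀ w, w ⊆ y → w ⊆ y' → g • w = w) ∧
      ∀ w, y ⊆ w → y' ⊆ w → g • w = w := by
  -- In each row met, the involution swaps the element of `y` with that of `y'`; all else is fixed.
  have hex : ∀ a : Fin (l * m), ∃ b : Fin (l * m), (b : ℕ) / l = (a : ℕ) / l ∧ (a ∈ y → b ∈ y') ∧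
      (a ∉ y → a ∈ y' → b ∈ y) ∧ (a ∉ y → a ∉ y' → b = a) := by
    intro a
    by_cases h1 : a ∈ y
    · obtain ⟨b, hb, hab⟩ := rowSet_subset_iff.1 h.le a h1
      exact ⟨b, hab, fun _ => hb, fun h => absurd h1 h, fun h => absurd h1 h⟩
    · by_cases h2 : a ∈ y'
      · obtain ⟨b, hb, hab⟩ := rowSet_subset_iff.1 h.ge a h2
        exact ⟨b, hab, fun h => absurd h h1, fun _ _ => hb, fun _ h => absurd h2 h⟩
      · exact ⟨a, rfl, fun h => absurd h h1, fun _ h => absurd h h2, fun _ _ => rfl⟩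
  choose f hrow hf1 hf2 hf3 using hex
  have hfix : ∀ a, a ∈ y → a ∈ y' → f a = a := fun a h1 h2 => hy' _ (hf1 a h1) _ h2 (hrow a)
  have hy'y : ∀ a ∈ y', f a ∈ y := fun a h2 => by
    by_cases h1 : a ∈ y
    · rwa [hfix a h1 h2]
    · exact hf2 a h1 h2
  have hinv : Function.Involutive f := by
    intro a
    by_cases h1 : a ∈ y
    · exact hy _ (hy'y _ (hf1 a h1)) _ h1 ((hrow _).trans (hrow a))
    · by_cases h2 : a ∈ y'
      · exact hy' _ (hf1 _ (hy'y a h2)) _ h2 ((hrow _).trans (hrow a))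
      · rw [hf3 a h1 h2, hf3 a h1 h2]
  refine ⟨⟨hinv.toPerm f, fun a b => ?_⟩, ?_, fun w hw hw' => ?_, fun w hw hw' => ?_⟩
  · rw [Function.Involutive.coe_toPerm, hrow, hrow]
  · ext a
    rw [mem_wreathSubgroup_smul]
    constructor
    · rintro ⟨b, hb, rfl⟩
      exact hf1 b hb
    · exact fun ha => ⟨f a, hy'y a ha, hinv a⟩
  · refine smul_eq_self_of_subset _ fun a ha => ?_
    obtain ⟨b, hb, rfl⟩ := mem_wreathSubgroup_smul.1 ha
    change f b ∈ w
    rwa [hfix b (hw hb) (hw' hb)]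
  · refine smul_eq_self_of_subset _ fun a ha => ?_
    obtain ⟨b, hb, rfl⟩ := mem_wreathSubgroup_smul.1 ha
    change f b ∈ w
    by_cases h1 : b ∈ y
    · exact hw' (hf1 b h1)
    · by_cases h2 : b ∈ y'
      · exact hw (hf2 b h1 h2)
      · rwa [hf3 b h1 h2]

/-- A partial transversal of the rows met by a set can be chosen inside it and around a given
smaller one. -/
theorem exists_transversal_between {z x : Finset (Fin (l * m))} (hz : IsPartialTransversal z)
    (hzx : z ⊆ x) : ∃ y, z ⊆ y ∧ y ⊆ x ∧ IsPartialTransversal y ∧ rowSet x = rowSet y := by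
  classical
  obtain ⟨y, hzy, hy⟩ := (Set.toFinite {y : Finset (Fin (l * m)) | y ⊆ x ∧
    IsPartialTransversal y}).exists_le_maximal ⟨hzx, hz⟩
  refine ⟨y, hzy, hy.prop.1, hy.prop.2, (rowSet_subset_iff.2 fun a ha => ?_).antisymm
    (rowSet_mono hy.prop.1)⟩
  by_contra! h
  have h1 : insert a y ≤ y := hy.le_of_ge ⟨Finset.insert_subset ha hy.prop.1, ?_⟩
    (Finset.subset_insert a y)
  · exact h a (h1 (Finset.mem_insert_self a y)) rfl
  · intro b hb c hc hbc
    rcases Finset.mem_insert.1 hb with rfl | hb' <;> rcases Finset.mem_insert.1 hc with rfl | hc'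
    · rfl
    · exact absurd hbc.symm (h c hc')
    · exact absurd hbc (h b hb')
    · exact hy.prop.2 b hb' c hc' hbc

/-- Guarantees that every chain, even the empty one, has a smallest non-transversal once the full
set is adjoined. -/
theorem not_isPartialTransversal_univ (hl : 2 ≤ l) (hm : 1 ≤ m) :
    ¬ IsPartialTransversal (Finset.univ : Finset (Fin (l * m))) := by
  have hlm : l ≤ l * m := Nat.le_mul_of_pos_right l hm
  intro h
  have := h ⟨0, by omega⟩ (Finset.mem_univ _) ⟨1, by omega⟩ (Finset.mem_univ _) (by
    simp [Nat.div_eq_of_lt (show 1 < l by omega)])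
  simp at this

/-! ### Transversals of a chain and their deletion. -/

/-- The partial transversals `y` meeting the same rows as some set in `c` (or the full set) that is
not a partial transversal. -/
def IsTransversalOf (c : Finset (Finset (Fin (l * m)))) (y : Finset (Fin (l * m))) : Prop :=
  IsPartialTransversal y ∧
    ∃ x ∈ insert Finset.univ c, ¬ IsPartialTransversal x ∧ rowSet x = rowSet y

/-- Only the non-transversals of the chain matter, so the condition survives adding or deleting
partial transversals. -/
theorem isTransversalOf_congr {c d : Finset (Finset (Fin (l * m)))}
    (h : ∀ x, ¬ IsPartialTransversal x → (x ∈ c ↔ x ∈ d)) (y : Finset (Fin (l * m))) :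
    IsTransversalOf c y ↔ IsTransversalOf d y := by
  refine and_congr_right fun _ => exists_congr fun x => ?_
  have := h x
  rw [Finset.mem_insert, Finset.mem_insert]
  tauto

theorem IsTransversalOf.of_smul (g : wreathSubgroup l m) {c : Finset (Finset (Fin (l * m)))}
    {y : Finset (Fin (l * m))} (h : IsTransversalOf c y) : IsTransversalOf (g • c) (g • y) := by
  obtain ⟨h1, x, hx, h2, h3⟩ := h
  refine ⟨(isPartialTransversal_smul g y).2 h1, g • x, ?_,
    mt (isPartialTransversal_smul g x).1 h2,
    ((rowSet_smul_subset g x y).2 h3.le).antisymm ((rowSet_smul_subset g y x).2 h3.ge)⟩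
  rcases Finset.mem_insert.1 hx with rfl | hx
  · rw [smul_univ_wreath]
    exact Finset.mem_insert_self _ _
  · exact Finset.mem_insert_of_mem (Finset.smul_mem_smul_finset hx)

theorem isTransversalOf_smul (g : wreathSubgroup l m) (c : Finset (Finset (Fin (l * m))))
    (y : Finset (Fin (l * m))) : IsTransversalOf (g • c) (g • y) ↔ IsTransversalOf c y :=
  ⟨fun h => by simpa using h.of_smul g⁻¹, fun h => h.of_smul g⟩

/-- In a chain, a transversal of `c` is below each set that is not a partial transversal. -/
theorem IsTransversalOf.subset {c : Finset (Finset (Fin (l * m)))} {y x : Finset (Fin (l * m))}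
    (hy : IsTransversalOf c y) (hyc : y ∈ c) (hc : ∀ u ∈ c, ∀ v ∈ c, u ⊆ v ∨ v ⊆ u)
    (hx : x ∈ insert Finset.univ c) (hxt : ¬ IsPartialTransversal x) : y ⊆ x := by
  rcases Finset.mem_insert.1 hx with rfl | hx
  · exact Finset.subset_univ y
  · exact (hc y hyc x hx).resolve_right fun h => hxt (hy.1.mono h)

open Classical in
/-- Delete from a chain the transversals of it. -/
noncomputable def deleteTransversal (c : Finset (Finset (Fin (l * m)))) :
    Finset (Finset (Fin (l * m))) :=
  c.filter fun y => ¬ IsTransversalOf c y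

open Classical in
/-- The members of a chain that are not partial transversals. -/
noncomputable def nonTransversals (c : Finset (Finset (Fin (l * m)))) :
    Finset (Finset (Fin (l * m))) :=
  c.filter fun x => ¬ IsPartialTransversal x

theorem mem_deleteTransversal {c : Finset (Finset (Fin (l * m)))} {y : Finset (Fin (l * m))} :
    y ∈ deleteTransversal c ↔ y ∈ c ∧ ¬ IsTransversalOf c y := by
  simp [deleteTransversal]

theorem mem_nonTransversals {c : Finset (Finset (Fin (l * m)))} {y : Finset (Fin (l * m))} :
    y ∈ nonTransversals c ↔ y ∈ c ∧ ¬ IsPartialTransversal y := by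
  simp [nonTransversals]

theorem mem_deleteTransversal_iff_of_not {c : Finset (Finset (Fin (l * m)))}
    {x : Finset (Fin (l * m))} (hx : ¬ IsPartialTransversal x) :
    x ∈ deleteTransversal c ↔ x ∈ c := by
  rw [mem_deleteTransversal]
  exact ⟨fun h => h.1, fun h => ⟨h, fun h' => hx h'.1⟩⟩

theorem isTransversalOf_deleteTransversal (c : Finset (Finset (Fin (l * m))))
    (y : Finset (Fin (l * m))) :
    IsTransversalOf (deleteTransversal c) y ↔ IsTransversalOf c y :=
  isTransversalOf_congr (fun _ hx => mem_deleteTransversal_iff_of_not hx) y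

theorem deleteTransversal_smul (g : wreathSubgroup l m) (c : Finset (Finset (Fin (l * m)))) :
    deleteTransversal (g • c) = g • deleteTransversal c := by
  ext y
  obtain ⟨y, rfl⟩ : ∃ y', g • y' = y := ⟨g⁻¹ • y, smul_inv_smul _ _⟩
  rw [Finset.smul_mem_smul_finset_iff, mem_deleteTransversal, mem_deleteTransversal,
    Finset.smul_mem_smul_finset_iff, isTransversalOf_smul]

theorem nonTransversals_smul (g : wreathSubgroup l m) (c : Finset (Finset (Fin (l * m)))) :
    nonTransversals (g • c) = g • nonTransversals c := by
  ext y
  obtain ⟨y, rfl⟩ : ∃ y', g • y' = y := ⟨g⁻¹ • y, smul_inv_smul _ _⟩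
  rw [Finset.smul_mem_smul_finset_iff, mem_nonTransversals, mem_nonTransversals,
    Finset.smul_mem_smul_finset_iff, isPartialTransversal_smul]

/-- Each of `y`, `y'` lies inside the set whose rows the other one meets. This serves both for two
members of one chain and for members of two chains with the same non-transversals. -/
theorem IsTransversalOf.rowSet_eq {c : Finset (Finset (Fin (l * m)))}
    {y y' : Finset (Fin (l * m))} (hy : IsTransversalOf c y) (hy' : IsTransversalOf c y')
    (h : ∀ x ∈ insert Finset.univ c, ¬ IsPartialTransversal x → y ⊆ x ∧ y' ⊆ x) :
    rowSet y = rowSet y' := by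
  obtain ⟨-, x, hx, hxt, hxy⟩ := hy
  obtain ⟨-, x', hx', hxt', hxy'⟩ := hy'
  refine Set.Subset.antisymm ?_ ?_
  · rw [← hxy']
    exact rowSet_mono (h x' hx' hxt').1
  · rw [← hxy]
    exact rowSet_mono (h x hx hxt).2

theorem IsTransversalOf.eq {c : Finset (Finset (Fin (l * m)))}
    (hc : ∀ u ∈ c, ∀ v ∈ c, u ⊆ v ∨ v ⊆ u) {y y' : Finset (Fin (l * m))}
    (hy : IsTransversalOf c y) (hy' : IsTransversalOf c y') (hyc : y ∈ c) (hyc' : y' ∈ c) :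
    y = y' := by
  have h := hy.rowSet_eq hy' fun x hx hxt =>
    ⟨hy.subset hyc hc hx hxt, hy'.subset hyc' hc hx hxt⟩
  rcases hc y hyc y' hyc' with h1 | h1
  · exact hy'.1.eq_of_subset h1 h.ge
  · exact (hy.1.eq_of_subset h1 h.le).symm

theorem exists_eq_insert_deleteTransversal {c : Finset (Finset (Fin (l * m)))}
    (hc : ∀ u ∈ c, ∀ v ∈ c, u ⊆ v ∨ v ⊆ u) (h : c ≠ deleteTransversal c) :
    ∃ y ∈ c, IsTransversalOf c y ∧ c = insert y (deleteTransversal c) := by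
  obtain ⟨y, hyc, hy⟩ : ∃ y ∈ c, IsTransversalOf c y := by
    by_contra! h'
    refine h (Finset.ext fun y => ?_)
    rw [mem_deleteTransversal]
    exact ⟨fun hy => ⟨hy, h' y hy⟩, fun hy => hy.1⟩
  refine ⟨y, hyc, hy, Finset.ext fun w => ?_⟩
  rw [Finset.mem_insert, mem_deleteTransversal]
  constructor
  · intro hw
    by_cases hwt : IsTransversalOf c w
    · exact Or.inl (hwt.eq hc hy hw hyc)
    · exact Or.inr ⟨hw, hwt⟩
  · rintro (rfl | hw)
    · exact hyc
    · exact hw.1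

/-- The new member is fitted between the largest partial transversal `z` and the smallest
non-transversal `x`. -/
theorem exists_deleteTransversal_eq (hl : 2 ≤ l) (hm : 1 ≤ m)
    {c : Finset (Finset (Fin (l * m)))}
    (hc : ∀ u ∈ c, ∀ v ∈ c, u ⊆ v ∨ v ⊆ u) (hcp : ∀ u ∈ c, u.Nonempty ∧ u ≠ Finset.univ)
    (h : deleteTransversal c = c) :
    ∃ d ∈ (orderComplex (Finset (Fin (l * m)))).faces, deleteTransversal d = c ∧ d ≠ c := by
  classical
  have huniv := not_isPartialTransversal_univ hl hm
  have hc' : ∀ u ∈ insert Finset.univ c, ∀ v ∈ insert Finset.univ c, u ⊆ v ∨ v ⊆ u := by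
    intro u hu v hv
    rcases Finset.mem_insert.1 hu with rfl | hu
    · exact Or.inr (Finset.subset_univ _)
    · rcases Finset.mem_insert.1 hv with rfl | hv
      · exact Or.inl (Finset.subset_univ _)
      · exact hc u hu v hv
  obtain ⟨x, hx⟩ := (Set.toFinite {x | x ∈ insert Finset.univ c ∧
    ¬ IsPartialTransversal x}).exists_minimal ⟨Finset.univ, Finset.mem_insert_self _ _, huniv⟩
  have hxmin : ∀ w ∈ insert Finset.univ c, ¬ IsPartialTransversal w → x ⊆ w := fun w hw hwt =>
    (hc' x hx.prop.1 w hw).elim id fun h => hx.le_of_le ⟨hw, hwt⟩ h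
  obtain ⟨z, hz, hzx, hzc⟩ : ∃ z, IsPartialTransversal z ∧ z ⊆ x ∧
      ∀ w ∈ c, IsPartialTransversal w → w ⊆ z := by
    by_cases hne : {w | w ∈ c ∧ IsPartialTransversal w}.Nonempty
    · obtain ⟨z, hz⟩ := (Set.toFinite {w | w ∈ c ∧ IsPartialTransversal w}).exists_maximal hne
      refine ⟨z, hz.prop.2, ?_, fun w hw hwt => (hc w hw z hz.prop.1).elim id fun h =>
        hz.le_of_ge ⟨hw, hwt⟩ h⟩
      exact (hc' z (Finset.mem_insert_of_mem hz.prop.1) x hx.prop.1).resolve_right fun h =>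
        hx.prop.2 (hz.prop.2.mono h)
    · exact ⟨∅, fun a ha => absurd ha (Finset.notMem_empty a), Finset.empty_subset _,
        fun w hw hwt => absurd ⟨w, hw, hwt⟩ hne⟩
  obtain ⟨y, hzy, hyx, hyt, hrow⟩ := exists_transversal_between hz hzx
  have hyof : IsTransversalOf c y := ⟨hyt, x, hx.prop.1, hx.prop.2, hrow⟩
  have hyc : y ∉ c := fun hyc => by
    rw [← h, mem_deleteTransversal] at hyc
    exact hyc.2 hyof
  have hcomp : ∀ w ∈ c, w ⊆ y ∨ y ⊆ w := fun w hw => by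
    by_cases hwt : IsPartialTransversal w
    · exact Or.inl ((hzc w hw hwt).trans hzy)
    · exact Or.inr (hyx.trans (hxmin w (Finset.mem_insert_of_mem hw) hwt))
  have hof : ∀ w, IsTransversalOf (insert y c) w ↔ IsTransversalOf c w :=
    isTransversalOf_congr fun w hw => by
      rw [Finset.mem_insert]
      refine ⟨fun h => h.resolve_left ?_, Or.inr⟩
      rintro rfl
      exact hw hyt
  refine ⟨insert y c, mem_orderComplex_finset.2 ⟨Finset.insert_nonempty _ _, ?_, ?_⟩, ?_, ?_⟩
  · intro u hu v hv
    rcases Finset.mem_insert.1 hu with rfl | hu' <;> rcases Finset.mem_insert.1 hv with rfl | hv'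
    · exact Or.inl subset_rfl
    · exact (hcomp v hv').symm
    · exact hcomp u hu'
    · exact hc u hu' v hv'
  · intro u hu
    rcases Finset.mem_insert.1 hu with rfl | hu
    · refine ⟨Finset.nonempty_iff_ne_empty.2 ?_, ?_⟩
      · rintro rfl
        -- If `y` were empty, `x` would meet no row and hence be a partial transversal.
        have hxe : x = ∅ := by simpa [rowSet] using hrow
        exact hx.prop.2 (by rw [hxe]; exact hyt)
      · rintro rfl
        exact huniv hyt
    · exact hcp u hu
  · ext w
    rw [mem_deleteTransversal, hof, Finset.mem_insert]
    constructor
    · rintro ⟨rfl | hw, hw'⟩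
      · exact absurd hyof hw'
      · exact hw
    · intro hw
      refine ⟨Or.inr hw, ?_⟩
      rw [← h, mem_deleteTransversal] at hw
      exact hw.2
  · exact fun he => hyc (he ▸ Finset.mem_insert_self y c)

theorem exists_smul_eq_of_deleteTransversal_eq {d e : Finset (Finset (Fin (l * m)))}
    (hd : ∀ u ∈ d, ∀ v ∈ d, u ⊆ v ∨ v ⊆ u) (he : ∀ u ∈ e, ∀ v ∈ e, u ⊆ v ∨ v ⊆ u)
    (h : deleteTransversal d = deleteTransversal e) (hdd : d ≠ deleteTransversal d)
    (hee : e ≠ deleteTransversal e) : ∃ g : wreathSubgroup l m, g • d = e := by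
  classical
  obtain ⟨y, hyd, hy, hdi⟩ := exists_eq_insert_deleteTransversal hd hdd
  obtain ⟨y', hye, hy', hei⟩ := exists_eq_insert_deleteTransversal he hee
  have hmem : ∀ x, ¬ IsPartialTransversal x → (x ∈ d ↔ x ∈ e) := fun x hx => by
    rw [← mem_deleteTransversal_iff_of_not hx, h, mem_deleteTransversal_iff_of_not hx]
  have hmem' : ∀ x, ¬ IsPartialTransversal x →
      (x ∈ insert Finset.univ d ↔ x ∈ insert Finset.univ e) := fun x hx => by
    rw [Finset.mem_insert, Finset.mem_insert, hmem x hx]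
  have hy'd : IsTransversalOf d y' := (isTransversalOf_congr hmem y').2 hy'
  have hsub : ∀ x ∈ insert Finset.univ d, ¬ IsPartialTransversal x → y ⊆ x ∧ y' ⊆ x :=
    fun x hx hxt => ⟨hy.subset hyd hd hx hxt, hy'.subset hye he ((hmem' x hxt).1 hx) hxt⟩
  obtain ⟨g, hgy, hg1, hg2⟩ := exists_smul_eq_of_rowSet_eq hy.1 hy'.1 (hy.rowSet_eq hy'd hsub)
  -- A partial transversal of the chain containing `u` is squeezed between `u` and `x`, so it meets
  -- the same rows and would have been deleted too.
  have below : ∀ c : Finset (Finset (Fin (l * m))), (∀ u ∈ c, ∀ v ∈ c, u ⊆ v ∨ v ⊆ u) →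
      ∀ u ∈ c, IsTransversalOf c u → ∀ w ∈ deleteTransversal c, IsPartialTransversal w →
        w ⊆ u := by
    intro c hc u huc hu w hw hwt
    obtain ⟨hw1, hw2⟩ := mem_deleteTransversal.1 hw
    refine (hc w hw1 u huc).elim id fun huw => absurd ⟨hwt, ?_⟩ hw2
    obtain ⟨-, x, hx, hxt, hxu⟩ := hu
    refine ⟨x, hx, hxt, Set.Subset.antisymm (hxu.le.trans (rowSet_mono huw)) (rowSet_mono ?_)⟩
    rcases Finset.mem_insert.1 hx with rfl | hx
    · exact Finset.subset_univ _
    · exact (hc w hw1 x hx).resolve_right fun h => hxt (hwt.mono h)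
  have hfix : ∀ w ∈ deleteTransversal d, g • w = w := by
    intro w hw
    by_cases hwt : IsPartialTransversal w
    · exact hg1 w (below d hd y hyd hy w hw hwt) (below e he y' hye hy' w (h ▸ hw) hwt)
    · have := hsub w (Finset.mem_insert_of_mem (mem_deleteTransversal.1 hw).1) hwt
      exact hg2 w this.1 this.2
  refine ⟨g, ?_⟩
  rw [hdi, hei, ← h]
  change Finset.image _ _ = _
  rw [Finset.image_insert]
  rw [hgy]
  congr 1
  ext w
  rw [Finset.mem_image]
  exact ⟨fun ⟨u, hu, huw⟩ => by rwa [← huw, hfix u hu], fun hw => ⟨w, hw, hfix w hw⟩⟩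

theorem isCollapsible_of_two_le (hl : 2 ≤ l) (hm : 1 ≤ m) :
    IsCollapsible (BooleanWreathQuotient l m) := by
  refine QuotientComplex.isCollapsible_of_retraction smul_mem_orderComplex deleteTransversal
    (fun c => (nonTransversals c).card) (fun c y hy => (mem_deleteTransversal.1 hy).1)
    deleteTransversal_smul ?_ ?_ ?_ ?_ ?_ ?_ ?_
  · intro c
    ext y
    rw [mem_deleteTransversal, isTransversalOf_deleteTransversal, mem_deleteTransversal]
    tauto
  · intro c hc
    by_cases h : c = deleteTransversal c
    · rw [← h]
      exact Nat.le_succ _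
    · obtain ⟨y, -, -, h⟩ :=
        exists_eq_insert_deleteTransversal (mem_orderComplex_finset.1 hc).2.1 h
      conv_lhs => rw [h]
      exact Finset.card_insert_le _ _
  · intro g c
    rw [nonTransversals_smul, Finset.card_smul_finset]
  · intro c
    congr 1
    ext y
    rw [mem_nonTransversals, mem_nonTransversals]
    exact and_congr_left mem_deleteTransversal_iff_of_not
  · intro c e he hce hLc
    have hsub : nonTransversals c ⊆ nonTransversals e := fun x hx => by
      rw [mem_nonTransversals] at hx ⊢
      exact ⟨hce hx.1, hx.2⟩
    -- With equal non-transversals both chains have the same transversals, so no member of `c` is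
    -- deleted from `e`.
    by_cases heq : nonTransversals c = nonTransversals e
    · refine Or.inr ⟨congrArg _ heq, fun y hy => ?_⟩
      have h1 : ∀ x, ¬ IsPartialTransversal x → (x ∈ c ↔ x ∈ e) := fun x hx => by
        have := congrArg (x ∈ ·) heq
        simpa [mem_nonTransversals, hx] using this
      rw [mem_deleteTransversal, ← isTransversalOf_congr h1]
      refine ⟨hce hy, ?_⟩
      rw [← hLc, mem_deleteTransversal] at hy
      exact hy.2
    · exact Or.inl (Finset.card_lt_card (hsub.ssubset_of_ne heq))
  · rintro c (hc | rfl) h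
    · obtain ⟨-, h1, h2⟩ := mem_orderComplex_finset.1 hc
      exact exists_deleteTransversal_eq hl hm h1 h2 h
    · exact exists_deleteTransversal_eq hl hm (by simp) (by simp) h
  · intro d hd e he
    exact exists_smul_eq_of_deleteTransversal_eq (mem_orderComplex_finset.1 hd).2.1
      (mem_orderComplex_finset.1 he).2.1

end Wreath

/-! ### Rows of length one, by means of singletons. -/

section RowsOfLengthOne

variable {m : ℕ}

/-- Delete from a chain its singletons. -/
def deleteSingletons {α : Type*} [DecidableEq α] (c : Finset (Finset α)) : Finset (Finset α) :=
  c.filter fun u => u.card ≠ 1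

theorem mem_deleteSingletons {α : Type*} [DecidableEq α] {c : Finset (Finset α)} {u : Finset α} :
    u ∈ deleteSingletons c ↔ u ∈ c ∧ u.card ≠ 1 :=
  Finset.mem_filter

theorem exists_eq_insert_deleteSingletons {α : Type*} [DecidableEq α] {c : Finset (Finset α)}
    (hc : ∀ u ∈ c, ∀ v ∈ c, u ⊆ v ∨ v ⊆ u) (h : c ≠ deleteSingletons c) :
    ∃ a, c = insert {a} (deleteSingletons c) := by
  obtain ⟨y, hyc, hy⟩ : ∃ y ∈ c, y.card = 1 := by
    by_contra! h'
    refine h (Finset.ext fun y => ?_)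
    rw [mem_deleteSingletons]
    exact ⟨fun hy => ⟨hy, h' y hy⟩, fun hy => hy.1⟩
  obtain ⟨a, rfl⟩ := Finset.card_eq_one.1 hy
  refine ⟨a, Finset.ext fun w => ?_⟩
  rw [Finset.mem_insert, mem_deleteSingletons]
  constructor
  · intro hw
    by_cases hw1 : w.card = 1
    · left
      rcases hc w hw _ hyc with h1 | h1
      · exact Finset.eq_of_subset_of_card_le h1 (by rw [hw1, hy])
      · exact (Finset.eq_of_subset_of_card_le h1 (by rw [hw1, hy])).symm
    · exact Or.inr ⟨hw, hw1⟩
  · rintro (rfl | hw)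
    · exact hyc
    · exact hw.1

theorem exists_deleteSingletons_eq {α : Type*} [Fintype α] [DecidableEq α]
    (hα : 2 ≤ Fintype.card α) {c : Finset (Finset α)}
    (hc : ∀ u ∈ c, ∀ v ∈ c, u ⊆ v ∨ v ⊆ u) (hcp : ∀ u ∈ c, u.Nonempty ∧ u ≠ Finset.univ)
    (h : deleteSingletons c = c) :
    ∃ d ∈ (orderComplex (Finset α)).faces, deleteSingletons d = c ∧ d ≠ c := by
  -- Any element of the smallest member will do; for the empty chain, any element at all.
  obtain ⟨a, ha⟩ : ∃ a, ∀ u ∈ c, a ∈ u := by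
    by_cases hne : (c : Set (Finset α)).Nonempty
    · obtain ⟨x, hx⟩ := (Set.toFinite (c : Set (Finset α))).exists_minimal hne
      obtain ⟨a, ha⟩ := (hcp x hx.prop).1
      exact ⟨a, fun u hu => (hc x hx.prop u hu).elim (fun h => h ha) fun h => hx.le_of_le hu h ha⟩
    · have : Nonempty α := Fintype.card_pos_iff.1 (by omega)
      exact ⟨Classical.arbitrary α, fun u hu => absurd ⟨u, hu⟩ hne⟩
  have hac : {a} ∉ c := fun hac => by
    rw [← h, mem_deleteSingletons] at hac
    exact hac.2 (Finset.card_singleton a)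
  have hsub : ∀ u ∈ c, {a} ⊆ u := fun u hu => Finset.singleton_subset_iff.2 (ha u hu)
  refine ⟨insert {a} c, mem_orderComplex_finset.2 ⟨Finset.insert_nonempty _ _, ?_, ?_⟩, ?_, ?_⟩
  · intro u hu v hv
    rcases Finset.mem_insert.1 hu with rfl | hu' <;> rcases Finset.mem_insert.1 hv with rfl | hv'
    · exact Or.inl subset_rfl
    · exact Or.inl (hsub v hv')
    · exact Or.inr (hsub u hu')
    · exact hc u hu' v hv'
  · intro u hu
    rcases Finset.mem_insert.1 hu with rfl | hu'
    · refine ⟨Finset.singleton_nonempty a, fun h1 => ?_⟩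
      have := congrArg Finset.card h1
      rw [Finset.card_singleton, Finset.card_univ] at this
      omega
    · exact hcp u hu'
  · ext w
    rw [mem_deleteSingletons, Finset.mem_insert]
    constructor
    · rintro ⟨rfl | hw, hw'⟩
      · exact absurd (Finset.card_singleton a) hw'
      · exact hw
    · intro hw
      refine ⟨Or.inr hw, ?_⟩
      rw [← h, mem_deleteSingletons] at hw
      exact hw.2
  · exact fun he => hac (he ▸ Finset.mem_insert_self _ c)

theorem mem_wreathSubgroup_one (π : Equiv.Perm (Fin (1 * m))) : π ∈ wreathSubgroup 1 m := by
  intro x y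
  simp only [Nat.div_one, Fin.val_inj, π.injective.eq_iff]

theorem exists_smul_eq_of_deleteSingletons_eq {d e : Finset (Finset (Fin (1 * m)))}
    (hd : d ∈ (orderComplex (Finset (Fin (1 * m)))).faces)
    (he : e ∈ (orderComplex (Finset (Fin (1 * m)))).faces)
    (h : deleteSingletons d = deleteSingletons e) (hdd : d ≠ deleteSingletons d)
    (hee : e ≠ deleteSingletons e) : ∃ g : wreathSubgroup 1 m, g • d = e := by
  rw [mem_orderComplex_finset] at hd he
  obtain ⟨a, hdi⟩ := exists_eq_insert_deleteSingletons hd.2.1 hdd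
  obtain ⟨b, hei⟩ := exists_eq_insert_deleteSingletons he.2.1 hee
  have key : ∀ c ∈ (orderComplex (Finset (Fin (1 * m)))).faces, ∀ a, {a} ∈ c →
      ∀ w ∈ deleteSingletons c, a ∈ w := by
    intro c hc a ha w hw
    rw [mem_orderComplex_finset] at hc
    obtain ⟨hw1, hw2⟩ := mem_deleteSingletons.1 hw
    refine (hc.2.1 _ ha w hw1).elim Finset.singleton_subset_iff.1 fun h1 => ?_
    rcases Finset.subset_singleton_iff.1 h1 with rfl | rfl
    · exact absurd (hc.2.2 _ hw1).1 Finset.not_nonempty_empty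
    · exact Finset.mem_singleton_self a
  have ha := key d (mem_orderComplex_finset.2 hd) a (by rw [hdi]; exact Finset.mem_insert_self _ _)
  have hb := key e (mem_orderComplex_finset.2 he) b (by rw [hei]; exact Finset.mem_insert_self _ _)
  let g : wreathSubgroup 1 m := ⟨Equiv.swap a b, mem_wreathSubgroup_one _⟩
  -- Every other member contains both `a` and `b`, so the transposition preserves it.
  have hfix : ∀ w ∈ deleteSingletons d, g • w = w := by
    intro w hw
    refine smul_eq_self_of_subset _ fun x hx => ?_
    obtain ⟨z, hz, rfl⟩ := mem_wreathSubgroup_smul.1 hx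
    change Equiv.swap a b z ∈ w
    by_cases h1 : z = a
    · rw [h1, Equiv.swap_apply_left]
      exact hb w (h ▸ hw)
    · by_cases h2 : z = b
      · rw [h2, Equiv.swap_apply_right]
        exact ha w hw
      · rwa [Equiv.swap_apply_of_ne_of_ne h1 h2]
  have hg : g • ({a} : Finset (Fin (1 * m))) = {b} := by
    ext x
    rw [mem_wreathSubgroup_smul]
    simp [g, eq_comm]
  refine ⟨g, ?_⟩
  rw [hdi, hei, ← h]
  change Finset.image _ _ = _
  rw [Finset.image_insert, hg]
  congr 1
  ext w
  rw [Finset.mem_image]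
  exact ⟨fun ⟨u, hu, huw⟩ => by rwa [← huw, hfix u hu], fun hw => ⟨w, hw, hfix w hw⟩⟩

theorem isCollapsible_of_row_length_one (hm : 2 ≤ m) :
    IsCollapsible (BooleanWreathQuotient 1 m) := by
  refine QuotientComplex.isCollapsible_of_retraction smul_mem_orderComplex deleteSingletons
    (fun _ => 0) (fun c => Finset.filter_subset _ c) ?_ ?_ ?_ (fun _ _ => rfl) (fun _ => rfl)
    ?_ ?_ ?_
  · intro g c
    ext y
    obtain ⟨y, rfl⟩ : ∃ y', g • y' = y := ⟨g⁻¹ • y, smul_inv_smul _ _⟩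
    rw [Finset.smul_mem_smul_finset_iff, mem_deleteSingletons, mem_deleteSingletons,
      Finset.smul_mem_smul_finset_iff]
    exact and_congr_right fun _ => not_congr (by rw [Finset.card_smul_finset g y])
  · intro c
    ext y
    rw [mem_deleteSingletons, mem_deleteSingletons]
    tauto
  · intro c hc
    by_cases h : c = deleteSingletons c
    · rw [← h]
      exact Nat.le_succ _
    · obtain ⟨a, h⟩ := exists_eq_insert_deleteSingletons (mem_orderComplex_finset.1 hc).2.1 h
      conv_lhs => rw [h]
      exact Finset.card_insert_le _ _
  · intro c e _ hce hLc
    refine Or.inr ⟨rfl, fun y hy => mem_deleteSingletons.2 ⟨hce hy, ?_⟩⟩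
    rw [← hLc, mem_deleteSingletons] at hy
    exact hy.2
  · have hα : 2 ≤ Fintype.card (Fin (1 * m)) := by simpa using hm
    rintro c (hc | rfl) h
    · obtain ⟨-, h1, h2⟩ := mem_orderComplex_finset.1 hc
      exact exists_deleteSingletons_eq hα h1 h2 h
    · exact exists_deleteSingletons_eq hα (by simp) (by simp) h
  · intro d hd e he
    exact exists_smul_eq_of_deleteSingletons_eq hd he

end RowsOfLengthOne

theorem theorem4p1 (l m : ℕ) (hlm : 2 ≤ l * m) : IsCollapsible (BooleanWreathQuotient l m) := by
  have hm : 1 ≤ m := Nat.pos_of_ne_zero fun h => by simp [h] at hlm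
  have hl : 1 ≤ l := Nat.pos_of_ne_zero fun h => by simp [h] at hlm
  rcases hl.eq_or_lt with rfl | hl
  · exact isCollapsible_of_row_length_one (by simpa using hlm)
  · exact isCollapsible_of_two_le hl hm
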